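/- Let $\hbar=1$ and let $\mathcal H_B^{(A)}=\mathcal H_C^{(A)}=L^2(\mathbb R)$, so that $\mathcal H_B^{(A)}\otimes\mathcal H_C^{(A)}=L^2(\mathbb R^2)$ with wave functions $\psi(x_B,x_C)$. Let $\hat x_C$ be the position operator of $C$ (multiplication by $x_C$ on its maximal domain) and $\hat p_B=-i\,\partial/\partial x_B$ the momentum operator of $B$. Let $\mathcal P_{AC}:\mathcal H_B^{(A)}\otimes\mathcal H_C^{(A)}\to\mathcal H_A^{(C)}\otimes\mathcal H_B^{(C)}=L^2(\mathbb R^2)$ be the parity-swap $(\mathcal P_{AC}\psi)(q_A,q_B)=\psi(x_B=q_B,\,x_C=-q_A)$. For $P\in\mathbb R$ put $\hat S^P_{A\to C}=\mathcal P_{AC}\,e^{i\hat x_C(\hat p_B-P)}$, i.e. $e^{i\hat x_C(\hat p_B-P)}$ acts by $\psi(x_B,x_C)\mapsto e^{-ix_CP}\,\psi(x_B+x_C,x_C)$, and $\hat S_{A\to C}=\hat S^0_{A\to C}$. A bounded operator $\hat O$ on $\mathcal H_B^{(A)}\otimes\mathcal H_C^{(A)}$ is called invariant under $\hat S^P_{A\to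 C}$ if $\hat S^P_{A\to C}\,\hat O\,(\hat S^P_{A\to C})^\dagger=\mathcal P_{AC}\,\hat O\,\mathcal P_{AC}^\dagger$. **Theorem.** Let $\hat O=\sum_{k=1}^n\lambda_k\,\hat O_B^{(k)}\otimes\hat O_C^{(k)}$ be a bounded Hermitian operator on $\mathcal H_B^{(A)}\otimes\mathcal H_C^{(A)}$, where $n$ is finite, $\lambda_k>0$, and $(\hat O_B^{(k)})_k$ and $(\hat O_C^{(k)})_k$ are linearly independent families of bounded operators on $L^2(\mathbb R)$ (as is the case in a Schmidt decomposition, where these families are orthonormal for the trace inner product). Suppose that $\hat O$ is invariant under the standard transformation $\hat S_{A\to C}$. Then, for every $P\neq0$, $\hat O$ is invariant under the generalised transformation $\hat S^P_{A\to C}$ if and only if $[\hat x_C,\hat O_C^{(k)}]=0$ for all $k\in\{1,\dots,n\}$, meaning that $\hat O_C^{(k)}$ maps the domain of $\hat x_C$ into itself and $\hat x_C\hat O_C^{(k)}f=\hat O_C^{(k)}\hat x_Cf$ for every $f$ in that domain. -/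

import Mathlib

open MeasureTheory

noncomputable section

namespace QRF

/-- The Hilbert space `L²(ℝ)` of one particle on the line, in the position representation. -/
abbrev HOne : Type := Lp ℂ 2 (volume : Measure ℝ)

/-- The Hilbert space `L²(ℝ²)` of two particles on the line, in the position representation; it is
the Hilbert tensor product `L²(ℝ) ⊗ L²(ℝ)`, with product vectors given by `prodVec` below. -/
abbrev HTwo : Type := Lp ℂ 2 (volume : Measure (ℝ × ℝ))

/-- State space of `B` and `C` relative to `A`; wave functions `ψ (x_B, x_C)`. -/
abbrev HBC : Type := HTwo

/-- State space of `A` and `B` relative to `C`; wave functions `ψ (q_A, q_B)`. -/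
abbrev HAB : Type := HTwo

theorem memLp_prodVec (f g : HOne) :
    MemLp (fun z : ℝ × ℝ => f z.1 * g z.2) 2 (volume : Measure (ℝ × ℝ)) := by
  have hf := Lp.memLp f
  have hg := Lp.memLp g
  have hm : AEStronglyMeasurable (fun z : ℝ × ℝ => f z.1 * g z.2)
      (volume : Measure (ℝ × ℝ)) := hf.1.comp_fst.mul hg.1.comp_snd
  rw [memLp_two_iff_integrable_sq_norm hm]
  have h := Integrable.mul_prod ((memLp_two_iff_integrable_sq_norm hf.1).1 hf)
    ((memLp_two_iff_integrable_sq_norm hg.1).1 hg)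
  simp only [norm_mul, mul_pow]
  exact h

/-- The product vector `f ⊗ g`, i.e. the wave function `(y, x) ↦ f y * g x`. -/
def prodVec (f g : HOne) : HTwo := (memLp_prodVec f g).toLp _

/-- `O = ∑ₖ λₖ (O_B⁽ᵏ⁾ ⊗ O_C⁽ᵏ⁾)` is a decomposition of Schmidt type of the bounded operator `O`.

The identity of operators is expressed on product vectors, whose span is dense, so that it
determines `O`. The coefficients are positive. The families `O_B⁽ᵏ⁾` and `O_C⁽ᵏ⁾` are linearly
independent; this is implied by orthonormality for the trace inner product, and unlike the latter
it makes sense for bounded operators, such as the parity operator, that are not Hilbert–Schmidt. -/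
structure IsSchmidtDecomposition (O : HBC →L[ℂ] HBC) {n : ℕ} (lam : Fin n → ℝ)
    (OB OC : Fin n → (HOne →L[ℂ] HOne)) : Prop where
  coeff_pos : ∀ k, 0 < lam k
  linearIndependent_left : LinearIndependent ℂ OB
  linearIndependent_right : LinearIndependent ℂ OC
  apply_prodVec : ∀ f g : HOne,
    O (prodVec f g) = ∑ k, (lam k : ℂ) • prodVec (OB k f) (OC k g)

/-- The position operator `x̂` on `L²(ℝ)`: multiplication by `x` on its maximal domain
`{f | x ↦ x * f x is square integrable}`. -/
def position : HOne →ₗ.[ℂ] HOne where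
  domain :=
    { carrier := {f | MemLp (fun x : ℝ => (x : ℂ) * f x) 2 volume}
      add_mem' := by
        intro f g hf hg
        refine (memLp_congr_ae ?_).1 (MemLp.add hf hg)
        filter_upwards [Lp.coeFn_add f g] with x hx
        simp only [Pi.add_apply, hx]
        ring
      zero_mem' := by
        refine (memLp_congr_ae ?_).1 (MemLp.zero' (ε := ℂ))
        filter_upwards [Lp.coeFn_zero ℂ 2 (volume : Measure ℝ)] with x hx
        rw [hx, Pi.zero_apply, mul_zero]
      smul_mem' := by
        intro c f hf
        refine (memLp_congr_ae ?_).1 (MemLp.const_smul hf c)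
        filter_upwards [Lp.coeFn_smul c f] with x hx
        simp only [Pi.smul_apply, hx, smul_eq_mul]
        ring }
  toFun :=
    { toFun := fun f => MemLp.toLp (fun x : ℝ => (x : ℂ) * (f : HOne) x) f.2
      map_add' := by
        intro f g
        rw [← MemLp.toLp_add]
        refine MemLp.toLp_congr _ _ ?_
        filter_upwards [Lp.coeFn_add (f : HOne) (g : HOne)] with x hx
        simp only [Submodule.coe_add, Pi.add_apply, hx]
        ring
      map_smul' := by
        intro c f
        rw [RingHom.id_apply, ← MemLp.toLp_const_smul]
        refine MemLp.toLp_congr _ _ ?_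
        filter_upwards [Lp.coeFn_smul c (f : HOne)] with x hx
        simp only [Submodule.coe_smul, Pi.smul_apply, hx, smul_eq_mul]
        ring }

/-- `[X, T] = 0` for a possibly unbounded operator `X` and a bounded operator `T`: `T` maps the
domain of `X` into itself and `X T f = T X f` there. -/
def CommutesWith (X : HOne →ₗ.[ℂ] HOne) (T : HOne →L[ℂ] HOne) : Prop :=
  ∀ f : X.domain, ∃ h : T (f : HOne) ∈ X.domain, X ⟨T (f : HOne), h⟩ = T (X f)

theorem memLp_phase (P : ℝ) (f : HBC) :
    MemLp (fun z : ℝ × ℝ => Complex.exp (-(Complex.I * (z.2 : ℂ) * (P : ℂ))) * f z) 2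
      (volume : Measure (ℝ × ℝ)) := by
  have hf := Lp.memLp f
  have hc : Continuous fun z : ℝ × ℝ => Complex.exp (-(Complex.I * (z.2 : ℂ) * (P : ℂ))) := by
    fun_prop
  refine hf.of_le (hc.aestronglyMeasurable.mul hf.1) (Filter.Eventually.of_forall fun z => ?_)
  rw [norm_mul, Complex.norm_exp]
  simp

/-- The unitary `e^{-i x̂_C P}`: multiplication of `ψ (x_B, x_C)` by the phase `e^{-i x_C P}`. -/
def phase (P : ℝ) : HBC →ₗᵢ[ℂ] HBC where
  toFun f := (memLp_phase P f).toLp _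
  map_add' := by
    intro f g
    rw [← MemLp.toLp_add]
    refine MemLp.toLp_congr _ _ ?_
    filter_upwards [Lp.coeFn_add f g] with x hx
    simp only [Pi.add_apply, hx]
    ring
  map_smul' := by
    intro c f
    rw [RingHom.id_apply, ← MemLp.toLp_const_smul]
    refine MemLp.toLp_congr _ _ ?_
    filter_upwards [Lp.coeFn_smul c f] with x hx
    simp only [Pi.smul_apply, hx, smul_eq_mul]
    ring
  norm_map' := by
    intro f
    change ‖(memLp_phase P f).toLp _‖ = ‖f‖
    rw [Lp.norm_toLp, Lp.norm_def]
    congr 1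
    refine eLpNorm_congr_norm_ae (Filter.Eventually.of_forall fun z => ?_)
    rw [norm_mul, Complex.norm_exp]
    simp

theorem measurePreserving_shear :
    MeasurePreserving (fun z : ℝ × ℝ => (z.1 + z.2, z.2)) volume volume :=
  measurePreserving_add_prod (volume : Measure ℝ) (volume : Measure ℝ)

/-- The quantum-controlled translation `e^{i x̂_C p̂_B}`. As `p̂_B = -i ∂/∂x_B` generates the
translations, `(e^{i a p̂_B} φ) (x_B) = φ (x_B + a)`, one has
`(e^{i x̂_C p̂_B} ψ) (x_B, x_C) = ψ (x_B + x_C, x_C)`. -/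
def controlledTranslation : HBC →ₗᵢ[ℂ] HBC :=
  Lp.compMeasurePreservingₗᵢ ℂ (fun z : ℝ × ℝ => (z.1 + z.2, z.2)) measurePreserving_shear

theorem measurePreserving_paritySwap :
    MeasurePreserving (fun z : ℝ × ℝ => (z.2, -z.1)) volume volume := by
  have h1 : MeasurePreserving (fun z : ℝ × ℝ => (-z.1, z.2)) volume volume :=
    (Measure.measurePreserving_neg (volume : Measure ℝ)).prod
      (MeasurePreserving.id (volume : Measure ℝ))
  have h2 : MeasurePreserving (Prod.swap : ℝ × ℝ → ℝ × ℝ) volume volume :=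
    Measure.measurePreserving_swap
  exact h2.comp h1

/-- The parity-swap operator `𝒫_AC = ∫ dx |-x⟩_A ⟨x|_C` from the state space relative to `A` to the
state space relative to `C`: `(𝒫_AC ψ) (q_A, q_B) = ψ (x_B = q_B, x_C = -q_A)`. -/
def paritySwap : HBC →L[ℂ] HAB :=
  (Lp.compMeasurePreservingₗᵢ ℂ (fun z : ℝ × ℝ => (z.2, -z.1))
    measurePreserving_paritySwap).toContinuousLinearMap

/-- The generalised transformation `Ŝ^P_{A→C} = 𝒫_AC e^{i x̂_C (p̂_B - P)}` for total momentum `P`;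
the commuting factors `e^{i x̂_C p̂_B}` and `e^{-i x̂_C P}` of the exponential are written out. -/
def transform (P : ℝ) : HBC →L[ℂ] HAB :=
  paritySwap ∘L (controlledTranslation.toContinuousLinearMap ∘L (phase P).toContinuousLinearMap)

/-- The standard transformation `Ŝ_{A→C} = 𝒫_AC e^{i x̂_C p̂_B}`. -/
def standardTransform : HBC →L[ℂ] HAB :=
  paritySwap ∘L controlledTranslation.toContinuousLinearMap

/-- `O` is invariant under the transformation `S`: `S O S† = 𝒫_AC O 𝒫_AC†`. -/
def IsInvariant (S : HBC →L[ℂ] HAB) (O : HBC →L[ℂ] HBC) : Prop :=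
  S ∘L O ∘L ContinuousLinearMap.adjoint S =
    paritySwap ∘L O ∘L ContinuousLinearMap.adjoint paritySwap

end QRF

end

/-! Invariance under `Ŝ` and `Ŝ^P` says that `O` commutes with `U = e^{i x̂_C p̂_B}` and with
`e^{-i x̂_C P}`. Since the `O_B⁽ᵏ⁾` are linearly independent, the latter means that each `O_C⁽ᵏ⁾`
commutes with `e^{-i x̂ P}`; this gives one direction, because `e^{-i x̂ P}` is a strong limit of
powers of resolvents of `x̂`.

Conversely, `O_C⁽ᵏ⁾` then commutes with all Fourier modes of period `L = 2π/|P|`, so it acts between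
two cells of length `L` fibrewise, pairing `x` with `x + d` for the offset `d ∈ Lℤ` of the cells.
Commutation with `U` now shows that, for almost every `x`, the operator
`B(x) = ∑ₖ λₖ ⟨φ(x), (O_C⁽ᵏ⁾ f)(x)⟩ O_B⁽ᵏ⁾` intertwines the translations by `x + d` and by `x`. If
`d ≠ 0`, nonzero intertwiners for different `x` are linearly independent, because translations tend
weakly to zero at infinity, while all `B(x)` lie in the span of finitely many operators; hence
`B(x) = 0` almost everywhere. So `O_C⁽ᵏ⁾` does not couple different cells, it commutes with every
bounded function of `x̂`, and through the resolvent it commutes with `x̂`. -/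

open MeasureTheory

namespace QRF

open Filter Topology ContinuousLinearMap

section General

theorem eq_zero_of_sum_mul_inner_eq_zero {ι H : Type*} [Fintype ι] [NormedAddCommGroup H]
    [InnerProductSpace ℂ H] {A : ι → H →L[ℂ] H} (hA : LinearIndependent ℂ A) {c : ι → ℂ}
    (h : ∀ u v, ∑ k, c k * inner ℂ u (A k v) = 0) (k : ι) : c k = 0 := by
  refine Fintype.linearIndependent_iff.1 hA c (ContinuousLinearMap.ext fun v =>
    ext_inner_left ℂ fun u => ?_) k
  simpa [sum_apply, inner_sum, inner_smul_right] using h u v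

theorem ae_forall_eq_of_continuous {α E Y : Type*} [MeasurableSpace α] {μ : Measure α}
    [TopologicalSpace E] [TopologicalSpace.SeparableSpace E] [TopologicalSpace Y] [T2Space Y]
    {p q : α → E → Y} (hp : ∀ x, Continuous (p x)) (hq : ∀ x, Continuous (q x))
    (h : ∀ e, ∀ᵐ x ∂μ, p x e = q x e) : ∀ᵐ x ∂μ, ∀ e, p x e = q x e := by
  obtain ⟨s, hsc, hsd⟩ := TopologicalSpace.exists_countable_dense E
  filter_upwards [(ae_ball_iff hsc).2 fun e _ => h e] with x hx e
  exact congrFun ((hp x).ext_on hsd (hq x) hx) e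

theorem ae_eq_zero_of_setIntegral_prod_eq_zero {α β E : Type*} [MeasurableSpace α]
    [MeasurableSpace β] [NormedAddCommGroup E] [NormedSpace ℝ E] [CompleteSpace E]
    {ρ : Measure (α × β)} {F : α × β → E} (hF : Integrable F ρ)
    (h : ∀ s t, MeasurableSet s → MeasurableSet t → ∫ z in s ×ˢ t, F z ∂ρ = 0) : F =ᵐ[ρ] 0 := by
  suffices hF0 : ∀ r, MeasurableSet r → ∫ z in r, F z ∂ρ = 0 from
    hF.ae_eq_zero_of_forall_setIntegral_eq_zero fun r hr _ => hF0 r hr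
  intro r hr
  induction r, hr using MeasurableSpace.induction_on_inter generateFrom_prod.symm
    isPiSystem_prod with
  | empty => simp
  | basic r hr =>
    obtain ⟨s, hs, t, ht, rfl⟩ := hr
    exact h s t hs ht
  | compl r hr ih =>
    have huniv := h Set.univ Set.univ .univ .univ
    rwa [Set.univ_prod_univ, setIntegral_univ, ← integral_add_compl hr hF, ih, zero_add] at huniv
  | iUnion r hd hr ih =>
    rw [integral_iUnion hr hd hF.integrableOn]
    simp [ih]

end General

section Multiplication

variable {α : Type*} [MeasurableSpace α] {μ : Measure α}
  {T : Lp ℂ 2 μ →L[ℂ] Lp ℂ 2 μ} {h h₁ h₂ : α → ℂ} {C : ℝ}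

/-- The bounded operator `T` commutes with multiplication by `h` on its maximal domain; `h` is
allowed to be unbounded. -/
def CommutesWithMul (T : Lp ℂ 2 μ →L[ℂ] Lp ℂ 2 μ) (h : α → ℂ) : Prop :=
  ∀ f g : Lp ℂ 2 μ, g =ᵐ[μ] (fun x => h x * f x) → T g =ᵐ[μ] fun x => h x * T f x

/-- `f` belongs to the subspace `L²(s)` of `L²`: it vanishes almost everywhere outside `s`. -/
def SupportedOn (s : Set α) (f : Lp ℂ 2 μ) : Prop :=
  ∀ᵐ x ∂μ, x ∉ s → f x = 0

theorem exists_coeFn_eq_mul (hm : Measurable h) (hC : ∀ x, ‖h x‖ ≤ C) (f : Lp ℂ 2 μ) :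
    ∃ g : Lp ℂ 2 μ, g =ᵐ[μ] fun x => h x * f x := by
  have hf := Lp.memLp f
  have hhf : MemLp (fun x => h x * f x) 2 μ := by
    refine hf.of_le_mul (c := C) (hm.aestronglyMeasurable.mul hf.1) (.of_forall fun x => ?_)
    rw [norm_mul]
    gcongr
    exact hC x
  exact ⟨hhf.toLp _, hhf.coeFn_toLp⟩

theorem exists_coeFn_eq_indicator {s : Set α} (hs : MeasurableSet s) (f : Lp ℂ 2 μ) :
    ∃ g : Lp ℂ 2 μ, g =ᵐ[μ] s.indicator f :=
  ⟨((Lp.memLp f).indicator hs).toLp _, MemLp.coeFn_toLp _⟩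

theorem inner_eq_integral_mul {f g : Lp ℂ 2 μ} (hg : g =ᵐ[μ] fun x => h x * f x)
    (φ : Lp ℂ 2 μ) : inner ℂ φ g = ∫ x, h x * inner ℂ (φ x) (f x) ∂μ := by
  rw [L2.inner_def]
  refine integral_congr_ae ?_
  filter_upwards [hg] with x hx
  rw [hx, ← smul_eq_mul, inner_smul_right]

theorem inner_eq_integral_mul_of_conj {φ ψ : Lp ℂ 2 μ}
    (hψ : ψ =ᵐ[μ] fun x => starRingEnd ℂ (h x) * φ x) (f : Lp ℂ 2 μ) :
    inner ℂ ψ f = ∫ x, h x * inner ℂ (φ x) (f x) ∂μ := by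
  rw [L2.inner_def]
  refine integral_congr_ae ?_
  filter_upwards [hψ] with x hx
  rw [hx, ← smul_eq_mul, inner_smul_left, Complex.conj_conj]

theorem commutesWithMul_iff_integral (hm : Measurable h) (hC : ∀ x, ‖h x‖ ≤ C) :
    CommutesWithMul T h ↔ ∀ φ f : Lp ℂ 2 μ,
      ∫ x, h x * inner ℂ (φ x) (T f x) ∂μ = ∫ x, h x * inner ℂ (adjoint T φ x) (f x) ∂μ := by
  constructor
  · intro H φ f
    obtain ⟨g, hg⟩ := exists_coeFn_eq_mul hm hC f
    rw [← inner_eq_integral_mul (H f g hg), ← inner_eq_integral_mul hg, adjoint_inner_left]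
  · intro H f g hg
    obtain ⟨k, hk⟩ := exists_coeFn_eq_mul hm hC (T f)
    have hTg : T g = k := ext_inner_left ℂ fun φ => by
      rw [← adjoint_inner_left, inner_eq_integral_mul hg, inner_eq_integral_mul hk, H]
    rwa [hTg]

theorem ae_eq_zero_of_inner_eq_zero {s : Set α} (hs : MeasurableSet s) {ψ : Lp ℂ 2 μ}
    (hψ : ∀ φ : Lp ℂ 2 μ, SupportedOn s φ → inner ℂ φ ψ = 0) : ∀ᵐ x ∂μ, x ∈ s → ψ x = 0 := by
  obtain ⟨φ, hφ⟩ := exists_coeFn_eq_indicator hs ψ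
  have hφs : SupportedOn s φ := by
    filter_upwards [hφ] with x hx hxs
    rw [hx, Set.indicator_of_notMem hxs]
  have hφψ : inner ℂ φ φ = inner ℂ φ ψ := by
    rw [L2.inner_def, L2.inner_def]
    refine integral_congr_ae ?_
    filter_upwards [hφ] with x hx
    by_cases hxs : x ∈ s <;> simp [hx, hxs]
  have hφ0 : φ = 0 := inner_self_eq_zero.1 (hφψ.trans (hψ φ hφs))
  filter_upwards [hφ, (Lp.eq_zero_iff_ae_eq_zero).1 hφ0] with x hx h0 hxs
  rwa [h0, Pi.zero_apply, Set.indicator_of_mem hxs, eq_comm] at hx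

theorem eq_zero_of_inner_supportedOn_eq_zero {ι : Type*} [Countable ι] {s : ι → Set α}
    (hs : ∀ i, MeasurableSet (s i)) (hcov : ⋃ i, s i = Set.univ) {ψ : Lp ℂ 2 μ}
    (hψ : ∀ i φ, SupportedOn (s i) φ → inner ℂ φ ψ = 0) : ψ = 0 := by
  rw [Lp.eq_zero_iff_ae_eq_zero]
  filter_upwards [ae_all_iff.2 fun i => ae_eq_zero_of_inner_eq_zero (hs i) (hψ i)] with x hx
  obtain ⟨i, hi⟩ := Set.iUnion_eq_univ_iff.1 hcov x
  exact hx i hi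

namespace CommutesWithMul

theorem inv (H : CommutesWithMul T h) (h0 : ∀ x, h x ≠ 0) :
    CommutesWithMul T (fun x => (h x)⁻¹) := by
  intro f g hg
  have hf : f =ᵐ[μ] fun x => h x * g x := by
    filter_upwards [hg] with x hx
    rw [hx, mul_inv_cancel_left₀ (h0 x)]
  filter_upwards [H g f hf] with x hx
  rw [hx, inv_mul_cancel_left₀ (h0 x)]

theorem const (T : Lp ℂ 2 μ →L[ℂ] Lp ℂ 2 μ) (c : ℂ) : CommutesWithMul T (fun _ => c) := by
  intro f g hg
  have hgf : g = c • f := Lp.ext (hg.trans (Lp.coeFn_smul c f).symm)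
  rw [hgf, map_smul]
  exact Lp.coeFn_smul c (T f)

theorem affine (H : CommutesWithMul T h) (c : ℂ) {b : ℂ} (hb : b ≠ 0) :
    CommutesWithMul T (fun x => c + b * h x) := by
  intro f g hg
  have hk : (b⁻¹ • (g - c • f) : Lp ℂ 2 μ) =ᵐ[μ] fun x => h x * f x := by
    filter_upwards [hg, Lp.coeFn_smul b⁻¹ (g - c • f), Lp.coeFn_sub g (c • f),
      Lp.coeFn_smul c f] with x hgx h₁ h₂ h₃
    rw [h₁, Pi.smul_apply, h₂, Pi.sub_apply, h₃, Pi.smul_apply, hgx, smul_eq_mul, smul_eq_mul,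
      add_mul, add_sub_cancel_left, mul_assoc, inv_mul_cancel_left₀ hb]
  have hTk := H f _ hk
  rw [map_smul, map_sub, map_smul] at hTk
  filter_upwards [hTk, Lp.coeFn_smul b⁻¹ (T g - c • T f), Lp.coeFn_sub (T g) (c • T f),
    Lp.coeFn_smul c (T f)] with x hx h₁ h₂ h₃
  rw [h₁, Pi.smul_apply, h₂, Pi.sub_apply, h₃, Pi.smul_apply, smul_eq_mul, smul_eq_mul,
    inv_mul_eq_iff_eq_mul₀ hb] at hx
  linear_combination hx

theorem mul (H₁ : CommutesWithMul T h₁) (H₂ : CommutesWithMul T h₂) (hm : Measurable h₂)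
    (hC : ∀ x, ‖h₂ x‖ ≤ C) : CommutesWithMul T (fun x => h₁ x * h₂ x) := by
  intro f g hg
  obtain ⟨k, hk⟩ := exists_coeFn_eq_mul hm hC f
  have hgk : g =ᵐ[μ] fun x => h₁ x * k x := by
    filter_upwards [hg, hk] with x hgx hkx
    rw [hgx, hkx, mul_assoc]
  filter_upwards [H₂ f k hk, H₁ k g hgk] with x hkx hgx
  rw [hgx, hkx, mul_assoc]

theorem pow (H : CommutesWithMul T h) (hm : Measurable h) (hC : ∀ x, ‖h x‖ ≤ C) (n : ℕ) :
    CommutesWithMul T (fun x => h x ^ n) := by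
  induction n with
  | zero => simpa only [pow_zero] using const T 1
  | succ n ih => simpa only [pow_succ] using ih.mul H hm hC

theorem zpow (H : CommutesWithMul T h) (hm : Measurable h) (hC : ∀ x, ‖h x‖ ≤ C)
    (h0 : ∀ x, h x ≠ 0) : ∀ j : ℤ, CommutesWithMul T (fun x => h x ^ j)
  | .ofNat n => by simpa only [Int.ofNat_eq_natCast, zpow_natCast] using H.pow hm hC n
  | .negSucc n => by
    simpa only [zpow_negSucc] using (H.pow hm hC (n + 1)).inv fun x => pow_ne_zero _ (h0 x)

theorem of_tendsto {h : ℕ → α → ℂ} {h₀ : α → ℂ} (hm : ∀ n, Measurable (h n))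
    (hC : ∀ n x, ‖h n x‖ ≤ C) (hlim : ∀ x, Tendsto (fun n => h n x) atTop (𝓝 (h₀ x)))
    (H : ∀ n, CommutesWithMul T (h n)) : CommutesWithMul T h₀ := by
  have hC₀ : ∀ x, ‖h₀ x‖ ≤ C := fun x => le_of_tendsto (hlim x).norm (.of_forall fun n => hC n x)
  have hm₀ : Measurable h₀ := measurable_of_tendsto_metrizable hm (tendsto_pi_nhds.2 hlim)
  have hint : ∀ φ f : Lp ℂ 2 μ, Tendsto (fun n => ∫ x, h n x * inner ℂ (φ x) (f x) ∂μ) atTop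
      (𝓝 (∫ x, h₀ x * inner ℂ (φ x) (f x) ∂μ)) := fun φ f => by
    have hφf : Integrable (fun x => inner ℂ (φ x) (f x)) μ := L2.integrable_inner φ f
    refine tendsto_integral_of_dominated_convergence (fun x => C * ‖inner ℂ (φ x) (f x)‖)
      (fun n => (hm n).aestronglyMeasurable.mul hφf.1) (hφf.norm.const_mul C)
      (fun n => .of_forall fun x => ?_) (.of_forall fun x => (hlim x).mul_const _)
    rw [norm_mul]
    gcongr
    exact hC n x
  refine (commutesWithMul_iff_integral hm₀ hC₀).2 fun φ f =>
    tendsto_nhds_unique (hint φ (T f)) ((hint (adjoint T φ) f).congr fun n => ?_)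
  exact ((commutesWithMul_iff_integral (hm n) (hC n)).1 (H n) φ f).symm

theorem of_supportedOn {ι : Type*} [Countable ι] {s : ι → Set α} (hs : ∀ i, MeasurableSet (s i))
    (hcov : ⋃ i, s i = Set.univ) (hm : Measurable h) (hC : ∀ x, ‖h x‖ ≤ C)
    (H : ∀ i j φ f, SupportedOn (s i) φ → SupportedOn (s j) f →
      ∫ x, h x * inner ℂ (φ x) (T f x) ∂μ = ∫ x, h x * inner ℂ (adjoint T φ x) (f x) ∂μ) :
    CommutesWithMul T h := by
  have hleft : ∀ j φ f, SupportedOn (s j) f →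
      ∫ x, h x * inner ℂ (φ x) (T f x) ∂μ = ∫ x, h x * inner ℂ (adjoint T φ x) (f x) ∂μ := by
    intro j φ f hf
    obtain ⟨g, hg⟩ := exists_coeFn_eq_mul hm hC f
    obtain ⟨k, hk⟩ := exists_coeFn_eq_mul hm hC (T f)
    have hkg : k - T g = 0 := eq_zero_of_inner_supportedOn_eq_zero hs hcov fun i χ hχ => by
      rw [inner_sub_right, ← adjoint_inner_left, inner_eq_integral_mul hk,
        inner_eq_integral_mul hg, H i j χ f hχ hf, sub_self]
    rw [← inner_eq_integral_mul hk, ← inner_eq_integral_mul hg, adjoint_inner_left,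
      sub_eq_zero.1 hkg]
  rw [commutesWithMul_iff_integral hm hC]
  intro φ f
  have hm' : Measurable fun x => starRingEnd ℂ (h x) := Complex.continuous_conj.measurable.comp hm
  have hC' : ∀ x, ‖starRingEnd ℂ (h x)‖ ≤ C := fun x => (RCLike.norm_conj _).trans_le (hC x)
  obtain ⟨g, hg⟩ := exists_coeFn_eq_mul hm' hC' φ
  obtain ⟨k, hk⟩ := exists_coeFn_eq_mul hm' hC' (adjoint T φ)
  have hgk : adjoint T g - k = 0 := eq_zero_of_inner_supportedOn_eq_zero hs hcov fun j χ hχ => by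
    rw [inner_eq_zero_symm, inner_sub_left, adjoint_inner_left,
      inner_eq_integral_mul_of_conj hg, inner_eq_integral_mul_of_conj hk, hleft j φ χ hχ, sub_self]
  rw [← inner_eq_integral_mul_of_conj hg, ← inner_eq_integral_mul_of_conj hk,
    ← adjoint_inner_left, sub_eq_zero.1 hgk]

end CommutesWithMul

end Multiplication

section Position

variable {T : HOne →L[ℂ] HOne}

theorem commutesWith_position_iff :
    CommutesWith position T ↔ CommutesWithMul T (fun x => (x : ℂ)) := by
  constructor
  · intro H f g hg
    have hf : f ∈ position.domain := (memLp_congr_ae hg).1 (Lp.memLp g)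
    obtain ⟨hTf, hcomm⟩ := H ⟨f, hf⟩
    have hfg : position ⟨f, hf⟩ = g := Lp.ext ((MemLp.coeFn_toLp hf).trans hg.symm)
    rw [← hfg, ← hcomm]
    exact MemLp.coeFn_toLp hTf
  · intro H f
    have hTf := H f (position f) (MemLp.coeFn_toLp f.2)
    have hdom : T (f : HOne) ∈ position.domain := (memLp_congr_ae hTf).1 (Lp.memLp _)
    exact ⟨hdom, Lp.ext ((MemLp.coeFn_toLp hdom).trans hTf.symm)⟩

theorem one_add_mul_I_mul_ne_zero (s x : ℝ) : (1 : ℂ) + s * Complex.I * x ≠ 0 := fun h => by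
  simpa using congrArg Complex.re h

theorem norm_inv_one_add_mul_I_mul_le (s x : ℝ) : ‖((1 : ℂ) + s * Complex.I * x)⁻¹‖ ≤ 1 := by
  rw [norm_inv]
  refine inv_le_one_of_one_le₀ ?_
  simpa using Complex.abs_re_le_norm ((1 : ℂ) + s * Complex.I * x)

theorem measurable_inv_one_add_mul_I_mul (s : ℝ) :
    Measurable fun x : ℝ => ((1 : ℂ) + s * Complex.I * x)⁻¹ := by
  fun_prop

theorem CommutesWithMul.position_of_bounded
    (H : ∀ (h : ℝ → ℂ) (C : ℝ), Measurable h → (∀ x, ‖h x‖ ≤ C) → CommutesWithMul T h) :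
    CommutesWithMul T (fun x => (x : ℂ)) := by
  have hres := H _ 1 (measurable_inv_one_add_mul_I_mul 1) (norm_inv_one_add_mul_I_mul_le 1)
  have hx := (hres.inv fun x => inv_ne_zero (one_add_mul_I_mul_ne_zero 1 x)).affine
    Complex.I (neg_ne_zero.2 Complex.I_ne_zero)
  convert hx using 2 with x
  rw [inv_inv]
  push_cast
  linear_combination (x : ℂ) * Complex.I_mul_I

theorem tendsto_resolvent_pow_exp (x t : ℝ) :
    Tendsto (fun n : ℕ => ((1 : ℂ) + ((t / (n + 1) : ℝ) : ℂ) * Complex.I * x)⁻¹ ^ (n + 1)) atTop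
      (𝓝 (Complex.exp (-(Complex.I * x * t)))) := by
  have hexp := (tendsto_add_atTop_iff_nat 1).2
    (Complex.tendsto_one_add_div_pow_exp (Complex.I * x * t))
  rw [Complex.exp_neg]
  refine (hexp.inv₀ (Complex.exp_ne_zero _)).congr fun n => ?_
  rw [inv_pow]
  congr 3
  push_cast
  ring

theorem CommutesWithMul.exp_of_position (H : CommutesWithMul T (fun x => (x : ℂ))) (t : ℝ) :
    CommutesWithMul T (fun x => Complex.exp (-(Complex.I * x * t))) := by
  rcases eq_or_ne t 0 with rfl | ht
  · simpa using const T 1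
  refine of_tendsto (fun n => (measurable_inv_one_add_mul_I_mul _).pow_const _) (C := 1)
    (fun n x => ?_) (fun x => tendsto_resolvent_pow_exp x t) fun n => ?_
  · rw [norm_pow]
    exact pow_le_one₀ (norm_nonneg _) (norm_inv_one_add_mul_I_mul_le _ _)
  · have hs : ((t / (n + 1) : ℝ) : ℂ) * Complex.I ≠ 0 :=
      mul_ne_zero (Complex.ofReal_ne_zero.2 (div_ne_zero ht n.cast_add_one_ne_zero))
        Complex.I_ne_zero
    exact ((H.affine 1 hs).inv (one_add_mul_I_mul_ne_zero _)).pow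
      (measurable_inv_one_add_mul_I_mul _) (norm_inv_one_add_mul_I_mul_le _) _

end Position

section Fourier

variable {L : ℝ}

theorem norm_fourier_coe_le (j : ℤ) (x : ℝ) : ‖fourier j (x : AddCircle L)‖ ≤ 1 := by
  rw [fourier_apply, Circle.norm_coe]

theorem continuous_continuousMap_coe (g : C(AddCircle L, ℂ)) :
    Continuous fun x : ℝ => g (x : AddCircle L) :=
  g.continuous.comp (AddCircle.continuous_mk' L)

theorem integrable_continuousMap_mul {F : ℝ → ℂ} (hF : Integrable F) [Fact (0 < L)]
    (g : C(AddCircle L, ℂ)) : Integrable fun x : ℝ => g (x : AddCircle L) * F x :=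
  hF.bdd_mul (continuous_continuousMap_coe g).aestronglyMeasurable
    (.of_forall fun x => g.norm_coe_le_norm x)

theorem integral_continuousMap_mul_eq_zero [Fact (0 < L)] {F : ℝ → ℂ} (hF : Integrable F)
    (hfour : ∀ j : ℤ, ∫ x : ℝ, fourier j (x : AddCircle L) * F x = 0) (g : C(AddCircle L, ℂ)) :
    ∫ x : ℝ, g (x : AddCircle L) * F x = 0 := by
  let Φ : C(AddCircle L, ℂ) →ₗ[ℂ] ℂ :=
    { toFun := fun g => ∫ x : ℝ, g (x : AddCircle L) * F x
      map_add' := fun g₁ g₂ => by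
        simp only [ContinuousMap.add_apply, add_mul]
        exact integral_add (integrable_continuousMap_mul hF g₁) (integrable_continuousMap_mul hF g₂)
      map_smul' := fun a g => by
        simp only [ContinuousMap.smul_apply, smul_eq_mul, mul_assoc, RingHom.id_apply]
        exact integral_const_mul a _ }
  have hΦ : Continuous Φ := by
    refine AddMonoidHomClass.continuous_of_bound Φ (∫ x, ‖F x‖) fun g => ?_
    refine (norm_integral_le_integral_norm _).trans ?_
    rw [mul_comm, ← integral_const_mul]
    refine integral_mono (integrable_continuousMap_mul hF g).norm (hF.norm.const_mul _) fun x => ?_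
    simp only [norm_mul]
    gcongr
    exact g.norm_coe_le_norm _
  have hker : (Submodule.span ℂ (Set.range (@fourier L))).topologicalClosure ≤ LinearMap.ker Φ := by
    refine Submodule.topologicalClosure_minimal _ (Submodule.span_le.2 ?_)
      (isClosed_singleton.preimage hΦ)
    rintro _ ⟨j, rfl⟩
    exact hfour j
  rw [span_fourier_closure_eq_top] at hker
  exact hker (Submodule.mem_top : g ∈ ⊤)

theorem ae_eq_zero_of_integral_fourier_mul_eq_zero [Fact (0 < L)] {F : ℝ → ℂ} (hF : Integrable F)
    {c : ℝ} (hsupp : ∀ᵐ x, x ∉ Set.Ico c (c + L) → F x = 0)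
    (hfour : ∀ j : ℤ, ∫ x : ℝ, fourier j (x : AddCircle L) * F x = 0) : ∀ᵐ x, F x = 0 := by
  have hIoo : ∀ᵐ x, x ∈ Set.Ioo c (c + L) → F x = 0 := by
    refine isOpen_Ioo.ae_eq_zero_of_integral_contDiff_smul_eq_zero
      (hF.locallyIntegrable.locallyIntegrableOn _) fun g hg _ hgs => ?_
    have hg0 : ∀ x, x ∉ Set.Ioo c (c + L) → g x = 0 := fun x hx =>
      by_contra fun h0 => hx (hgs (subset_tsupport g h0))
    let G : C(AddCircle L, ℂ) := ⟨AddCircle.liftIco L c (fun x => (g x : ℂ)),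
      AddCircle.liftIco_continuous (by simp [hg0 c (by simp), hg0 (c + L) (by simp)])
        (Complex.continuous_ofReal.comp hg.continuous).continuousOn⟩
    rw [← integral_continuousMap_mul_eq_zero hF hfour G]
    refine integral_congr_ae ?_
    filter_upwards [hsupp] with x hx
    by_cases hxI : x ∈ Set.Ico c (c + L)
    · rw [ContinuousMap.coe_mk, AddCircle.liftIco_coe_apply hxI, Complex.real_smul]
    · rw [hx hxI, smul_zero, mul_zero]
  filter_upwards [hsupp, hIoo, Measure.ae_ne volume c] with x hout hin hne
  by_cases hxI : x ∈ Set.Ico c (c + L)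
  · exact hin ⟨lt_of_le_of_ne hxI.1 hne.symm, hxI.2⟩
  · exact hout hxI

/-- The `n`-th cell of the partition of the line into half-open intervals of length `L`. -/
def cell (L : ℝ) (n : ℤ) : Set ℝ := Set.Ico (n • L) (n • L + L)

theorem measurableSet_cell (n : ℤ) : MeasurableSet (cell L n) := measurableSet_Ico

theorem iUnion_cell (hL : 0 < L) : ⋃ n, cell L n = Set.univ := by
  simpa only [cell, add_one_zsmul] using iUnion_Ico_zsmul hL

theorem add_zsmul_mem_cell_iff {a b : ℤ} {x : ℝ} :
    x + (b - a) • L ∈ cell L b ↔ x ∈ cell L a := by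
  simp only [cell, Set.mem_Ico, sub_zsmul]
  constructor <;> rintro ⟨hl, hr⟩ <;> constructor <;> linarith

theorem ae_eq_comp_add_of_integral_fourier_mul_eq [Fact (0 < L)] {F G : ℝ → ℂ}
    (hF : Integrable F) (hG : Integrable G) {a b : ℤ}
    (hFa : ∀ᵐ x, x ∉ cell L a → F x = 0) (hGb : ∀ᵐ x, x ∉ cell L b → G x = 0)
    (hfour : ∀ j : ℤ, ∫ x : ℝ, fourier j (x : AddCircle L) * F x =
      ∫ x : ℝ, fourier j (x : AddCircle L) * G x) :
    ∀ᵐ x, F x = G (x + (b - a) • L) := by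
  have hG' : Integrable fun x => G (x + (b - a) • L) := hG.comp_add_right _
  have hperiodic : ∀ x : ℝ, ((x + (b - a) • L : ℝ) : AddCircle L) = x := fun x => by
    rw [AddCircle.coe_add, AddCircle.coe_zsmul, AddCircle.coe_period, smul_zero, add_zero]
  have hsupp : ∀ᵐ x, x ∉ cell L a → F x - G (x + (b - a) • L) = 0 := by
    filter_upwards [hFa,
      (measurePreserving_add_right volume ((b - a) • L)).quasiMeasurePreserving.ae hGb]
      with x hFx hGx hx
    rw [hFx hx, hGx (add_zsmul_mem_cell_iff.not.2 hx), sub_zero]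
  have hz := ae_eq_zero_of_integral_fourier_mul_eq_zero (hF.sub hG') hsupp fun j => by
    simp only [Pi.sub_apply, mul_sub]
    rw [integral_sub (integrable_continuousMap_mul hF _) (integrable_continuousMap_mul hG' _),
      hfour, ← integral_add_right_eq_self (fun x : ℝ => fourier j (x : AddCircle L) * G x)
        ((b - a) • L)]
    simp only [hperiodic, sub_self]
  filter_upwards [hz] with x hx
  exact sub_eq_zero.1 hx

namespace CommutesWithMul

variable {T : HOne →L[ℂ] HOne}

theorem fourier {P : ℝ} (hP : P ≠ 0)
    (H : CommutesWithMul T (fun x => Complex.exp (-(Complex.I * x * P)))) (j : ℤ) :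
    CommutesWithMul T (fun x => _root_.fourier j (x : AddCircle (2 * Real.pi / |P|))) := by
  have hpow : ∀ i : ℤ, CommutesWithMul T (fun x => Complex.exp (-(Complex.I * x * P)) ^ i) :=
    H.zpow (C := 1) (by fun_prop) (fun x => by simp [Complex.norm_exp])
      (fun x => Complex.exp_ne_zero _)
  have hpi : (Real.pi : ℂ) ≠ 0 := Complex.ofReal_ne_zero.2 Real.pi_ne_zero
  have hP' : (P : ℂ) ≠ 0 := Complex.ofReal_ne_zero.2 hP
  rcases lt_or_gt_of_ne hP with hneg | hpos
  · convert hpow j using 2 with x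
    rw [fourier_coe_apply, abs_of_neg hneg, ← Complex.exp_int_mul]
    congr 1
    push_cast
    field_simp
  · convert hpow (-j) using 2 with x
    rw [fourier_coe_apply, abs_of_pos hpos, ← Complex.exp_int_mul]
    congr 1
    push_cast
    field_simp

theorem ae_inner_apply_eq_inner_adjoint_apply (hL : 0 < L)
    (H : ∀ j : ℤ, CommutesWithMul T (fun x => _root_.fourier j (x : AddCircle L))) {a b : ℤ}
    {φ f : HOne} (hφ : SupportedOn (cell L a) φ) (hf : SupportedOn (cell L b) f) :
    ∀ᵐ x, inner ℂ (φ x) (T f x) =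
      inner ℂ (adjoint T φ (x + (b - a) • L)) (f (x + (b - a) • L)) := by
  have : Fact (0 < L) := ⟨hL⟩
  refine ae_eq_comp_add_of_integral_fourier_mul_eq (L2.integrable_inner φ (T f))
    (L2.integrable_inner (adjoint T φ) f) ?_ ?_ fun j =>
      (commutesWithMul_iff_integral (continuous_continuousMap_coe _).measurable
        (norm_fourier_coe_le j)).1 (H j) φ f
  · filter_upwards [hφ] with x hx hxa
    rw [hx hxa, inner_zero_left]
  · filter_upwards [hf] with x hx hxb
    rw [hx hxb, inner_zero_right]

end CommutesWithMul

end Fourier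

section Translation

/-- The translation `e^{itp̂}` on `L²(ℝ)`, which acts by `f ↦ f (· + t)`. -/
noncomputable def translate (t : ℝ) : HOne →ₗᵢ[ℂ] HOne :=
  Lp.compMeasurePreservingₗᵢ ℂ (fun y : ℝ => y + t) (measurePreserving_add_right volume t)

theorem coeFn_translate (t : ℝ) (f : HOne) : translate t f =ᵐ[volume] fun y => f (y + t) :=
  Lp.coeFn_compMeasurePreserving f (measurePreserving_add_right volume t)

theorem translate_translate (s t : ℝ) (f : HOne) :
    translate s (translate t f) = translate (s + t) f := by
  refine Lp.ext ?_
  filter_upwards [coeFn_translate s (translate t f), coeFn_translate (s + t) f,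
    (measurePreserving_add_right volume s).quasiMeasurePreserving.ae (coeFn_translate t f)]
    with y hs hst ht
  rw [hs, hst, ht, add_assoc]

theorem translate_zero (f : HOne) : translate 0 f = f := by
  refine Lp.ext ?_
  filter_upwards [coeFn_translate 0 f] with y hy
  rw [hy, add_zero]

theorem continuous_translate (f : HOne) : Continuous fun t => translate t f := by
  have hg : Continuous fun t : ℝ => (⟨fun y => y + t, by fun_prop⟩ : C(ℝ, ℝ)) :=
    ContinuousMap.continuous_of_continuous_uncurry _ (by
      simp only [Function.uncurry_def, ContinuousMap.coe_mk]; fun_prop)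
  exact Continuous.compMeasurePreservingLp (f := fun _ : ℝ => f) continuous_const hg
    (fun t => measurePreserving_add_right volume t) (by simp)

theorem norm_inner_translate_le (u w : HOne) (s : ℝ) :
    ‖inner ℂ u (translate s w)‖ ≤ ‖u‖ * ‖w‖ :=
  (norm_inner_le_norm _ _).trans_eq (by rw [LinearIsometry.norm_map])

theorem inner_translate_eq_zero_of_supportedOn {u w : HOne} {R R' s : ℝ}
    (hu : SupportedOn (Metric.closedBall 0 R) u) (hw : SupportedOn (Metric.closedBall 0 R') w)
    (hs : R + R' < ‖s‖) : inner ℂ u (translate s w) = 0 := by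
  rw [L2.inner_def]
  refine integral_eq_zero_of_ae ?_
  filter_upwards [hu, coeFn_translate s w,
    (measurePreserving_add_right volume s).quasiMeasurePreserving.ae hw] with x hux hsx hwx
  by_cases hx : x ∈ Metric.closedBall 0 R
  · have hxs : x + s ∉ Metric.closedBall 0 R' := fun hxs => by
      rw [mem_closedBall_zero_iff] at hx hxs
      have := norm_sub_le (x + s) x
      rw [add_sub_cancel_left] at this
      linarith
    rw [hsx, hwx hxs, inner_zero_right, Pi.zero_apply]
  · rw [hux hx, inner_zero_left, Pi.zero_apply]

theorem dense_setOf_supportedOn_closedBall :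
    Dense {f : HOne | ∃ R, SupportedOn (Metric.closedBall 0 R) f} := by
  refine (Lp.dense_hasCompactSupport_contDiff (F := ℂ) (μ := (volume : Measure ℝ))
    (ENNReal.ofNat_ne_top (n := 2))).mono ?_
  rintro f ⟨g, hfg, hg, -⟩
  obtain ⟨R, hR⟩ := hg.isCompact.isBounded.subset_closedBall 0
  refine ⟨R, ?_⟩
  filter_upwards [hfg] with x hx hxR
  rw [hx]
  exact image_eq_zero_of_notMem_tsupport fun h => hxR (hR h)

theorem tendsto_zero_of_dense {ι X E : Type*} [PseudoMetricSpace X] [SeminormedAddCommGroup E]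
    {l : Filter ι} {F : ι → X → E} {K : NNReal} (hF : ∀ i, LipschitzWith K (F i)) {s : Set X}
    (hs : Dense s) (h : ∀ y ∈ s, Tendsto (F · y) l (𝓝 0)) (x : X) : Tendsto (F · x) l (𝓝 0) :=
  ((LipschitzWith.uniformEquicontinuous F K hF).equicontinuous x).tendsto_of_mem_closure
    (f := fun _ => 0) tendsto_const_nhds h (hs x)

theorem tendsto_inner_translate (u w : HOne) :
    Tendsto (fun s => inner ℂ u (translate s w)) (cocompact ℝ) (𝓝 0) := by
  have hLw : ∀ (w : HOne) (s : ℝ), LipschitzWith ‖w‖₊ fun u => inner ℂ u (translate s w) :=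
    fun w s => .of_dist_le_mul fun u u' => by
      rw [dist_eq_norm, dist_eq_norm, ← inner_sub_left, mul_comm]
      exact norm_inner_translate_le _ _ _
  have hLu : ∀ (u : HOne) (s : ℝ), LipschitzWith ‖u‖₊ fun w => inner ℂ u (translate s w) :=
    fun u s => .of_dist_le_mul fun w w' => by
      rw [dist_eq_norm, dist_eq_norm, ← inner_sub_right, ← map_sub]
      exact norm_inner_translate_le _ _ _
  refine tendsto_zero_of_dense (hLw w) dense_setOf_supportedOn_closedBall ?_ u
  rintro u ⟨R, hu⟩
  refine tendsto_zero_of_dense (hLu u) dense_setOf_supportedOn_closedBall ?_ w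
  rintro w ⟨R', hw⟩
  refine tendsto_const_nhds.congr' ?_
  filter_upwards [tendsto_norm_cocompact_atTop.eventually_gt_atTop (R + R')] with s hs
  exact (inner_translate_eq_zero_of_supportedOn hu hw hs).symm

theorem tendsto_inner_translate_of_tendsto {ι : Type*} {l : Filter ι} (u : HOne) {s : ι → ℝ}
    (hs : Tendsto s l (cocompact ℝ)) {w : ι → HOne} {w₀ : HOne} (hw : Tendsto w l (𝓝 w₀)) :
    Tendsto (fun i => inner ℂ u (translate (s i) (w i))) l (𝓝 0) := by
  have hdiff : Tendsto (fun i => inner ℂ u (translate (s i) (w i - w₀))) l (𝓝 0) := by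
    refine squeeze_zero_norm (fun i => norm_inner_translate_le u (w i - w₀) (s i)) ?_
    simpa only [mul_zero] using (tendsto_iff_norm_sub_tendsto_zero.1 hw).const_mul ‖u‖
  have hsum := hdiff.add ((tendsto_inner_translate u w₀).comp hs)
  rw [add_zero] at hsum
  refine hsum.congr fun i => ?_
  rw [Function.comp_apply, ← inner_add_right, ← map_add, sub_add_cancel]

theorem tendsto_inner_translate_of_isCompact (u : HOne) {K : Set HOne} (hK : IsCompact K)
    {s : ℕ → ℝ} (hs : Tendsto s atTop (cocompact ℝ)) {w : ℕ → HOne} (hw : ∀ N, w N ∈ K) :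
    Tendsto (fun N => inner ℂ u (translate (s N) (w N))) atTop (𝓝 0) := by
  refine tendsto_of_subseq_tendsto fun ns hns => ?_
  obtain ⟨w₀, -, ms, hms, hlim⟩ := hK.tendsto_subseq fun i => hw (ns i)
  exact ⟨ms, tendsto_inner_translate_of_tendsto u (hs.comp (hns.comp hms.tendsto_atTop)) hlim⟩

end Translation

section Intertwining

variable {B : HOne →L[ℂ] HOne} {a b a' b' : ℝ}

/-- The group of pairs `(a, b)` such that `B` intertwines the translations by `b` and by `a`. -/
noncomputable def intertwiningPairs (B : HOne →L[ℂ] HOne) : AddSubgroup (ℝ × ℝ) where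
  carrier := {p | ∀ v, translate p.1 (B v) = B (translate p.2 v)}
  add_mem' {p q} hp hq v := by
    rw [Prod.fst_add, Prod.snd_add, ← translate_translate, hq, hp, translate_translate]
  zero_mem' v := by
    rw [Prod.fst_zero, Prod.snd_zero, translate_zero, translate_zero]
  neg_mem' {p} hp v := by
    have h := hp (translate (-p.2) v)
    rw [translate_translate, add_neg_cancel, translate_zero] at h
    rw [Prod.fst_neg, Prod.snd_neg, ← h, translate_translate, neg_add_cancel, translate_zero]

theorem translate_add_apply_translate (h : (a, b) ∈ intertwiningPairs B) (s t : ℝ) (v : HOne) :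
    translate (s + a) (B (translate t v)) = translate s (B (translate (b + t) v)) := by
  rw [← translate_translate, h, translate_translate]

theorem mul_mem_intertwiningPairs (h : (a, b) ∈ intertwiningPairs B) (m : ℤ) :
    ((m : ℝ) * a, (m : ℝ) * b) ∈ intertwiningPairs B := by
  simpa only [Prod.smul_mk, zsmul_eq_mul] using zsmul_mem h m

theorem tendsto_mul_sub_floor_mul_cocompact (hb' : b' ≠ 0) (hdet : a * b' ≠ a' * b) :
    Tendsto (fun N : ℕ => N * a - ⌊N * b / b'⌋ * a') atTop (cocompact ℝ) := by
  set δ := (a * b' - a' * b) / b' with hδ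
  have hδ0 : 0 < |δ| := abs_pos.2 (div_ne_zero (sub_ne_zero.2 hdet) hb')
  rw [← Metric.cobounded_eq_cocompact, ← tendsto_norm_atTop_iff_cobounded]
  refine tendsto_atTop_mono (fun N => ?_) (tendsto_atTop_add_const_right _ (-|a'|)
    (tendsto_natCast_atTop_atTop.atTop_mul_const hδ0))
  have hsplit : N * δ = (N * a - ⌊N * b / b'⌋ * a') - Int.fract (N * b / b') * a' := by
    rw [← Int.self_sub_floor, hδ]
    field_simp
    ring
  have hfract : |Int.fract (N * b / b') * a'| ≤ |a'| := by
    rw [abs_mul, abs_of_nonneg (Int.fract_nonneg _)]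
    exact mul_le_of_le_one_left (abs_nonneg _) (Int.fract_lt_one _).le
  have htri := abs_sub (N * a - ⌊N * b / b'⌋ * a') (Int.fract (N * b / b') * a')
  rw [← hsplit, abs_mul, Nat.abs_cast] at htri
  rw [Real.norm_eq_abs]
  linarith

theorem tendsto_inner_translate_apply_translate (h : (a', b') ∈ intertwiningPairs B) (hb' : b' ≠ 0)
    (hdet : a * b' ≠ a' * b) (u v : HOne) :
    Tendsto (fun N : ℕ => inner ℂ u (translate (N * a) (B (translate (-(N * b)) v)))) atTop
      (𝓝 0) := by
  -- Multiples of `(a', b')` bring the inner translation into a compact set of translations.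
  have hreduce : ∀ N : ℕ, translate (N * a) (B (translate (-(N * b)) v)) =
      translate (N * a - ⌊N * b / b'⌋ * a')
        (B (translate (-(Int.fract (N * b / b') * b')) v)) := fun N => by
    have hmem := mul_mem_intertwiningPairs h ⌊N * b / b'⌋
    have hN := translate_add_apply_translate hmem (N * a - ⌊N * b / b'⌋ * a') (-(N * b)) v
    rw [sub_add_cancel] at hN
    rw [hN, ← Int.self_sub_floor, sub_mul, div_mul_cancel₀ _ hb', neg_sub, ← sub_eq_add_neg]
  have hK : IsCompact ((fun q : ℝ => B (translate (-(q * b')) v)) '' Set.Icc 0 1) :=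
    isCompact_Icc.image (B.continuous.comp ((continuous_translate v).comp (by fun_prop)))
  simp only [hreduce]
  exact tendsto_inner_translate_of_isCompact u hK (tendsto_mul_sub_floor_mul_cocompact hb' hdet)
    fun N => ⟨_, ⟨Int.fract_nonneg _, (Int.fract_lt_one _).le⟩, rfl⟩

theorem linearIndependent_of_mem_intertwiningPairs {ι : Type*} {a b : ι → ℝ}
    {B : ι → HOne →L[ℂ] HOne} (h : ∀ i, (a i, b i) ∈ intertwiningPairs (B i)) (hB : ∀ i, B i ≠ 0)
    (hb : ∀ i, b i ≠ 0) (hab : ∀ i j, i ≠ j → a i * b j ≠ a j * b i) :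
    LinearIndependent ℂ B := by
  classical
  rw [linearIndependent_iff']
  intro s c hc i hi
  by_contra hci
  refine hB i (ContinuousLinearMap.ext fun v => ext_inner_left ℂ fun u => ?_)
  have hfix : ∀ N : ℕ, translate (N * a i) (B i (translate (-(N * b i)) v)) = B i v := fun N => by
    have hmem : (N * a i, N * b i) ∈ intertwiningPairs (B i) :=
      mod_cast mul_mem_intertwiningPairs (h i) N
    have hN := translate_add_apply_translate hmem 0 (-(N * b i)) v
    rwa [zero_add, add_neg_cancel, translate_zero, translate_zero] at hN
  have hrel : ∀ N : ℕ, c i * inner ℂ u (B i v) = -∑ j ∈ s.erase i,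
      c j * inner ℂ u (translate (N * a i) (B j (translate (-(N * b i)) v))) := fun N => by
    have hN := congrArg (fun A : HOne →L[ℂ] HOne =>
      inner ℂ u (translate (N * a i) (A (translate (-(N * b i)) v)))) hc
    simp only [sum_apply, smul_apply, map_sum, map_smul, inner_sum, inner_smul_right, zero_apply,
      map_zero, inner_zero_right] at hN
    rw [← Finset.add_sum_erase _ _ hi, hfix] at hN
    exact eq_neg_of_add_eq_zero_left hN
  have hlim : Tendsto (fun N : ℕ => -∑ j ∈ s.erase i,
      c j * inner ℂ u (translate (N * a i) (B j (translate (-(N * b i)) v)))) atTop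
      (𝓝 (-∑ j ∈ s.erase i, c j * 0)) :=
    (tendsto_finsetSum _ fun j hj => (tendsto_inner_translate_apply_translate (h j) (hb j)
      (hab i j (Finset.ne_of_mem_erase hj).symm) u v).const_mul _).neg
  simp only [← hrel, mul_zero, Finset.sum_const_zero, neg_zero] at hlim
  have hzero := tendsto_nhds_unique tendsto_const_nhds hlim
  rwa [mul_eq_zero_iff_left hci, ← inner_zero_right (𝕜 := ℂ) u] at hzero

theorem ae_eq_zero_of_mem_intertwiningPairs {ι : Type*} [Finite ι] {A : ι → HOne →L[ℂ] HOne}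
    {B : ℝ → HOne →L[ℂ] HOne} (hB : ∀ x, B x ∈ Submodule.span ℂ (Set.range A)) {d : ℝ} (hd : d ≠ 0)
    (h : ∀ᵐ x, (x, x + d) ∈ intertwiningPairs (B x)) : ∀ᵐ x, B x = 0 := by
  let s : Set ℝ := {x | (x, x + d) ∈ intertwiningPairs (B x) ∧ B x ≠ 0 ∧ x + d ≠ 0}
  have hli : LinearIndependent ℂ fun x : s => B x :=
    linearIndependent_of_mem_intertwiningPairs (fun x => x.2.1) (fun x => x.2.2.1)
      (fun x => x.2.2.2) fun x y hxy heq => hxy <| Subtype.ext <| mul_right_cancel₀ hd <| by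
        linear_combination heq
  have hs : s.Finite := hli.finite_of_le_span_finite _ (Set.range A) <| by
    rintro _ ⟨x, rfl⟩
    exact hB x
  filter_upwards [h, hs.countable.ae_notMem volume, Measure.ae_ne volume (-d)] with x hx hxs hxd
  by_contra hBx
  exact hxs ⟨hx, hBx, fun h0 => hxd (eq_neg_of_add_eq_zero_left h0)⟩

end Intertwining

section ProductVectors

theorem coeFn_prodVec (f g : HOne) : prodVec f g =ᵐ[volume] fun z => f z.1 * g z.2 :=
  MemLp.coeFn_toLp _

theorem coeFn_controlledTranslation (ψ : HBC) :
    controlledTranslation ψ =ᵐ[volume] fun z => ψ (z.1 + z.2, z.2) :=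
  Lp.coeFn_compMeasurePreserving ψ measurePreserving_shear

theorem coeFn_phase (P : ℝ) (ψ : HBC) :
    phase P ψ =ᵐ[volume] fun z => Complex.exp (-(Complex.I * z.2 * P)) * ψ z :=
  MemLp.coeFn_toLp (memLp_phase P ψ)

theorem inner_prodVec (u φ v f : HOne) :
    inner ℂ (prodVec u φ) (prodVec v f) = inner ℂ u v * inner ℂ φ f := by
  rw [L2.inner_def, L2.inner_def, L2.inner_def, ← integral_prod_mul]
  refine integral_congr_ae ?_
  filter_upwards [coeFn_prodVec u φ, coeFn_prodVec v f] with z huφ hvf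
  simp only [huφ, hvf, RCLike.inner_apply, map_mul]
  ring

theorem inner_controlledTranslation_prodVec (u φ v f : HOne) :
    inner ℂ (prodVec u φ) (controlledTranslation (prodVec v f)) =
      ∫ x, inner ℂ (φ x) (f x) * inner ℂ u (translate x v) := by
  have hae : (fun z => inner ℂ (prodVec u φ z) (controlledTranslation (prodVec v f) z))
      =ᵐ[volume] fun z => inner ℂ (φ z.2) (f z.2) * inner ℂ (u z.1) (v (z.1 + z.2)) := by
    filter_upwards [coeFn_prodVec u φ, coeFn_controlledTranslation (prodVec v f),
      measurePreserving_shear.quasiMeasurePreserving.ae (coeFn_prodVec v f)] with z huφ hU hvf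
    rw [huφ, hU, hvf]
    simp only [RCLike.inner_apply, map_mul]
    ring
  have hint := (L2.integrable_inner (𝕜 := ℂ) (prodVec u φ)
    (controlledTranslation (prodVec v f))).congr hae
  rw [L2.inner_def, integral_congr_ae hae, Measure.volume_eq_prod, integral_prod_symm _ hint]
  refine integral_congr_ae (.of_forall fun x => ?_)
  simp only
  rw [integral_const_mul, L2.inner_def]
  congr 1
  refine integral_congr_ae ?_
  filter_upwards [coeFn_translate x v] with y hy
  rw [hy]

theorem setIntegral_prod_eq_zero_of_inner_prodVec {ψ : HTwo}
    (h : ∀ f g, inner ℂ (prodVec f g) ψ = 0) {s t : Set ℝ} (hs : MeasurableSet s)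
    (ht : MeasurableSet t) (hs' : volume s ≠ ⊤) (ht' : volume t ≠ ⊤) :
    ∫ z in s ×ˢ t, ψ z = 0 := by
  rw [← integral_indicator (hs.prod ht),
    ← h (indicatorConstLp 2 hs hs' 1) (indicatorConstLp 2 ht ht' 1), L2.inner_def]
  refine integral_congr_ae ?_
  filter_upwards [coeFn_prodVec (indicatorConstLp 2 hs hs' 1) (indicatorConstLp 2 ht ht' 1),
    Measure.quasiMeasurePreserving_fst.ae
      (indicatorConstLp_coeFn (p := 2) (hs := hs) (hμs := hs') (c := (1 : ℂ))),
    Measure.quasiMeasurePreserving_snd.ae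
      (indicatorConstLp_coeFn (p := 2) (hs := ht) (hμs := ht') (c := (1 : ℂ)))] with z hz hzs hzt
  rw [hz, hzs, hzt]
  by_cases hsz : z.1 ∈ s <;> by_cases htz : z.2 ∈ t <;> simp [hsz, htz]

theorem eq_zero_of_inner_prodVec {ψ : HTwo} (h : ∀ f g, inner ℂ (prodVec f g) ψ = 0) : ψ = 0 := by
  have hcell : ∀ a b : ℤ, ∀ᵐ z, z ∈ cell 1 a ×ˢ cell 1 b → ψ z = 0 := fun a b => by
    have hfin : ∀ n, volume (cell 1 n) ≠ ⊤ := fun n => by simp [cell]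
    have hint : IntegrableOn ψ (cell 1 a ×ˢ cell 1 b) :=
      integrableOn_Lp_of_measure_ne_top ψ (by norm_num) <| by
        rw [Measure.volume_eq_prod, Measure.prod_prod]
        exact ENNReal.mul_ne_top (hfin a) (hfin b)
    rw [← ae_restrict_iff' ((measurableSet_cell a).prod (measurableSet_cell b))]
    refine ae_eq_zero_of_setIntegral_prod_eq_zero hint fun s t hs ht => ?_
    rw [Measure.restrict_restrict (hs.prod ht), Set.prod_inter_prod]
    exact setIntegral_prod_eq_zero_of_inner_prodVec h (hs.inter (measurableSet_cell a))
      (ht.inter (measurableSet_cell b)) (measure_ne_top_of_subset Set.inter_subset_right (hfin a))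
      (measure_ne_top_of_subset Set.inter_subset_right (hfin b))
  rw [Lp.eq_zero_iff_ae_eq_zero]
  filter_upwards [ae_all_iff.2 fun a => ae_all_iff.2 (hcell a)] with z hz
  obtain ⟨a, ha⟩ := Set.iUnion_eq_univ_iff.1 (iUnion_cell one_pos) z.1
  obtain ⟨b, hb⟩ := Set.iUnion_eq_univ_iff.1 (iUnion_cell one_pos) z.2
  exact hz a b ⟨ha, hb⟩

theorem ext_prodVec {A B : HTwo →L[ℂ] HTwo} (h : ∀ f g, A (prodVec f g) = B (prodVec f g)) :
    A = B := by
  have hadj : ∀ χ, adjoint A χ = adjoint B χ := fun χ =>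
    sub_eq_zero.1 <| eq_zero_of_inner_prodVec fun f g => by
      rw [inner_sub_right, adjoint_inner_right, adjoint_inner_right, h, sub_self]
  exact adjoint.injective (ContinuousLinearMap.ext hadj)

end ProductVectors

section Invariance

variable {O : HBC →L[ℂ] HBC}

theorem controlledTranslation_surjective : Function.Surjective controlledTranslation := by
  have hm : MeasurePreserving (fun z : ℝ × ℝ => (z.1 - z.2, z.2)) volume volume :=
    measurePreserving_sub_prod (volume : Measure ℝ) (volume : Measure ℝ)
  intro ψ
  refine ⟨Lp.compMeasurePreserving _ hm ψ, Lp.ext ?_⟩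
  filter_upwards [coeFn_controlledTranslation (Lp.compMeasurePreserving _ hm ψ),
    measurePreserving_shear.quasiMeasurePreserving.ae (Lp.coeFn_compMeasurePreserving ψ hm)]
    with z hU hψ
  rw [hU, hψ]
  simp

theorem phase_surjective (P : ℝ) : Function.Surjective (phase P) := by
  intro ψ
  refine ⟨phase (-P) ψ, Lp.ext ?_⟩
  filter_upwards [coeFn_phase P (phase (-P) ψ), coeFn_phase (-P) ψ] with z hP hneg
  rw [hP, hneg, ← mul_assoc, ← Complex.exp_add]
  simp

theorem isInvariant_paritySwap_comp_iff {W : HBC →ₗᵢ[ℂ] HBC} (hW : Function.Surjective W) :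
    IsInvariant (paritySwap ∘L W.toContinuousLinearMap) O ↔ ∀ ψ, W (O ψ) = O (W ψ) := by
  set Q : HBC →ₗᵢ[ℂ] HAB := Lp.compMeasurePreservingₗᵢ ℂ (fun z : ℝ × ℝ => (z.2, -z.1))
    measurePreserving_paritySwap
  have hQ : paritySwap = Q.toContinuousLinearMap := rfl
  have hadj : ∀ (V : HBC →ₗᵢ[ℂ] HBC) ψ, adjoint V.toContinuousLinearMap (V ψ) = ψ := fun V ψ =>
    ext_inner_left ℂ fun χ => by
      rw [adjoint_inner_right]
      exact V.inner_map_map χ ψ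
  rw [IsInvariant, hQ, adjoint_comp]
  constructor
  · intro h ψ
    have hψ := DFunLike.congr_fun h (Q (W ψ))
    simp only [ContinuousLinearMap.comp_apply, hadj] at hψ
    exact Q.injective hψ
  · intro h
    ext1 χ
    obtain ⟨ψ, hψ⟩ := hW (adjoint Q.toContinuousLinearMap χ)
    simp only [ContinuousLinearMap.comp_apply, ← hψ, hadj]
    exact congrArg Q (h ψ)

theorem isInvariant_standardTransform_iff : IsInvariant standardTransform O ↔
    ∀ ψ, controlledTranslation (O ψ) = O (controlledTranslation ψ) :=
  isInvariant_paritySwap_comp_iff controlledTranslation_surjective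

theorem isInvariant_transform_iff (hO : IsInvariant standardTransform O) (P : ℝ) :
    IsInvariant (transform P) O ↔ ∀ ψ, phase P (O ψ) = O (phase P ψ) := by
  have hcomp := isInvariant_paritySwap_comp_iff (O := O)
    (W := controlledTranslation.comp (phase P))
    (controlledTranslation_surjective.comp (phase_surjective P))
  refine hcomp.trans (forall_congr' fun ψ => ?_)
  change controlledTranslation (phase P (O ψ)) = O (controlledTranslation (phase P ψ)) ↔ _
  rw [← isInvariant_standardTransform_iff.1 hO]
  exact controlledTranslation.injective.eq_iff

theorem exists_coeFn_eq_exp_mul (P : ℝ) (f : HOne) :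
    ∃ g : HOne, g =ᵐ[volume] fun x => Complex.exp (-(Complex.I * x * P)) * f x :=
  exists_coeFn_eq_mul (C := 1) (by fun_prop) (fun x => by simp [Complex.norm_exp]) f

theorem phase_prodVec {P : ℝ} {f g : HOne}
    (hg : g =ᵐ[volume] fun x => Complex.exp (-(Complex.I * x * P)) * f x) (v : HOne) :
    phase P (prodVec v f) = prodVec v g := by
  refine Lp.ext ?_
  filter_upwards [coeFn_phase P (prodVec v f), coeFn_prodVec v f, coeFn_prodVec v g,
    Measure.quasiMeasurePreserving_snd.ae hg] with z hP hvf hvg hgf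
  rw [hP, hvf, hvg, hgf]
  ring

end Invariance

theorem integrable_inner_mul_inner_translate (φ f u v : HOne) (d : ℝ) :
    Integrable fun x => inner ℂ (φ x) (f x) * inner ℂ u (translate (x + d) v) :=
  (L2.integrable_inner φ f).mul_bdd
    (continuous_const.inner ((continuous_translate v).comp (by fun_prop))).aestronglyMeasurable
    (.of_forall fun x => norm_inner_translate_le u v (x + d))

section PartialMatrixElement

variable {ι : Type*} [Fintype ι] {lam : ι → ℝ} {OB OC : ι → HOne →L[ℂ] HOne} {φ f : HOne}

/-- The operator `∑ₖ λₖ ⟨φ(x), (O_C⁽ᵏ⁾ f)(x)⟩ O_B⁽ᵏ⁾` on the `B` factor: the contribution of the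
position `x` of `C` to the partial matrix element of `∑ₖ λₖ O_B⁽ᵏ⁾ ⊗ O_C⁽ᵏ⁾` between `φ` and `f`. -/
noncomputable def partialMatrixElement (lam : ι → ℝ) (OB OC : ι → HOne →L[ℂ] HOne) (φ f : HOne)
    (x : ℝ) : HOne →L[ℂ] HOne :=
  ∑ k, ((lam k : ℂ) * inner ℂ (φ x) (OC k f x)) • OB k

theorem partialMatrixElement_mem_span (x : ℝ) :
    partialMatrixElement lam OB OC φ f x ∈ Submodule.span ℂ (Set.range OB) :=
  Submodule.sum_mem _ fun k _ =>
    Submodule.smul_mem _ _ (Submodule.subset_span (Set.mem_range_self k))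

theorem partialMatrixElement_ae_eq_indicator {s : Set ℝ} {φs : HOne}
    (hφs : φs =ᵐ[volume] s.indicator φ) : partialMatrixElement lam OB OC φs f =ᵐ[volume]
      s.indicator (partialMatrixElement lam OB OC φ f) := by
  filter_upwards [hφs] with x hx
  by_cases hxs : x ∈ s <;> simp [partialMatrixElement, hx, hxs]

theorem inner_partialMatrixElement_translate_apply (u v : HOne) (x y : ℝ) :
    inner ℂ u (partialMatrixElement lam OB OC φ f x (translate y v)) =
      ∑ k, (lam k : ℂ) *
        (inner ℂ (φ x) (OC k f x) * inner ℂ (adjoint (OB k) u) (translate y v)) := by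
  simp only [partialMatrixElement, sum_apply, smul_apply, inner_sum, inner_smul_right, mul_assoc,
    adjoint_inner_left]

theorem inner_translate_partialMatrixElement_apply (u v : HOne) (x : ℝ) :
    inner ℂ u (translate x (partialMatrixElement lam OB OC φ f x v)) =
      ∑ k, (lam k : ℂ) * (inner ℂ (φ x) (OC k f x) * inner ℂ u (translate x (OB k v))) := by
  simp only [partialMatrixElement, sum_apply, smul_apply, map_sum, map_smul, inner_sum,
    inner_smul_right, mul_assoc]

theorem integrable_inner_partialMatrixElement_translate (u v : HOne) (d : ℝ) :
    Integrable fun x =>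
      inner ℂ u (partialMatrixElement lam OB OC φ f x (translate (x + d) v)) := by
  simp only [inner_partialMatrixElement_translate_apply]
  exact integrable_finsetSum _ fun k _ =>
    (integrable_inner_mul_inner_translate φ (OC k f) _ v d).const_mul _

theorem integrable_inner_translate_partialMatrixElement (u v : HOne) :
    Integrable fun x => inner ℂ u (translate x (partialMatrixElement lam OB OC φ f x v)) := by
  simp only [inner_translate_partialMatrixElement_apply]
  exact integrable_finsetSum _ fun k _ => Integrable.const_mul
    (by simpa only [add_zero] using
      integrable_inner_mul_inner_translate φ (OC k f) u (OB k v) 0) _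

end PartialMatrixElement

namespace IsSchmidtDecomposition

variable {O : HBC →L[ℂ] HBC} {n : ℕ} {lam : Fin n → ℝ} {OB OC : Fin n → HOne →L[ℂ] HOne} {L : ℝ}
  {a b : ℤ} {φ f : HOne}

theorem coeff_ne_zero (hS : IsSchmidtDecomposition O lam OB OC) (k : Fin n) : (lam k : ℂ) ≠ 0 :=
  Complex.ofReal_ne_zero.2 (hS.coeff_pos k).ne'

theorem adjoint_apply_prodVec (hS : IsSchmidtDecomposition O lam OB OC) (u φ : HOne) :
    adjoint O (prodVec u φ) =
      ∑ k, (lam k : ℂ) • prodVec (adjoint (OB k) u) (adjoint (OC k) φ) := by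
  refine sub_eq_zero.1 (eq_zero_of_inner_prodVec fun v f => ?_)
  rw [inner_sub_right, adjoint_inner_right, hS.apply_prodVec, sum_inner, inner_sum, sub_eq_zero]
  simp only [inner_smul_left, inner_smul_right, inner_prodVec, adjoint_inner_right,
    Complex.conj_ofReal]

theorem commutesWithMul_of_phase_comm (hS : IsSchmidtDecomposition O lam OB OC) {P : ℝ}
    (h : ∀ ψ, phase P (O ψ) = O (phase P ψ)) (k : Fin n) :
    CommutesWithMul (OC k) (fun x => Complex.exp (-(Complex.I * x * P))) := by
  intro f g hg
  choose e he using fun k => exists_coeFn_eq_exp_mul P (OC k f)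
  suffices hge : OC k g = e k by
    rw [hge]
    exact he k
  refine ext_inner_left ℂ fun φ => ?_
  have hcoeff : ∀ k, (lam k : ℂ) * (inner ℂ φ (OC k g) - inner ℂ φ (e k)) = 0 := by
    refine eq_zero_of_sum_mul_inner_eq_zero hS.linearIndependent_left fun u v => ?_
    have huv := congrArg (inner ℂ (prodVec u φ)) (h (prodVec v f))
    rw [phase_prodVec hg, hS.apply_prodVec, hS.apply_prodVec, map_sum, inner_sum, inner_sum] at huv
    simp only [map_smul, phase_prodVec (he _), inner_smul_right, inner_prodVec] at huv
    rw [← sub_eq_zero.2 huv.symm, ← Finset.sum_sub_distrib]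
    exact Finset.sum_congr rfl fun k _ => by ring
  exact sub_eq_zero.1 ((mul_eq_zero.1 (hcoeff k)).resolve_left (hS.coeff_ne_zero k))

theorem phase_comm_of_commutesWithMul (hS : IsSchmidtDecomposition O lam OB OC) {P : ℝ}
    (h : ∀ k, CommutesWithMul (OC k) (fun x => Complex.exp (-(Complex.I * x * P)))) (ψ : HBC) :
    phase P (O ψ) = O (phase P ψ) := by
  refine DFunLike.congr_fun (ext_prodVec (A := (phase P).toContinuousLinearMap ∘L O)
    (B := O ∘L (phase P).toContinuousLinearMap) fun v f => ?_) ψ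
  obtain ⟨g, hg⟩ := exists_coeFn_eq_exp_mul P f
  simp only [ContinuousLinearMap.comp_apply, LinearIsometry.coe_toContinuousLinearMap]
  rw [phase_prodVec hg, hS.apply_prodVec, hS.apply_prodVec, map_sum]
  refine Finset.sum_congr rfl fun k _ => ?_
  rw [map_smul, phase_prodVec (h k f g hg)]

theorem sum_integral_inner_translate_eq (hS : IsSchmidtDecomposition O lam OB OC)
    (hU : ∀ ψ, controlledTranslation (O ψ) = O (controlledTranslation ψ)) (u φ v f : HOne) :
    ∑ k, (lam k : ℂ) * ∫ x, inner ℂ (φ x) (OC k f x) * inner ℂ u (translate x (OB k v)) =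
      ∑ k, (lam k : ℂ) *
        ∫ x, inner ℂ (adjoint (OC k) φ x) (f x) * inner ℂ (adjoint (OB k) u) (translate x v) := by
  have huv := congrArg (inner ℂ (prodVec u φ)) (hU (prodVec v f))
  rw [← adjoint_inner_left, hS.adjoint_apply_prodVec, hS.apply_prodVec, map_sum, inner_sum,
    sum_inner] at huv
  simpa only [map_smul, inner_smul_right, inner_smul_left, Complex.conj_ofReal,
    inner_controlledTranslation_prodVec] using huv

theorem integral_inner_translate_partialMatrixElement (hS : IsSchmidtDecomposition O lam OB OC)
    (hU : ∀ ψ, controlledTranslation (O ψ) = O (controlledTranslation ψ)) (hL : 0 < L)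
    (hOC : ∀ k (j : ℤ), CommutesWithMul (OC k) (fun x => fourier j (x : AddCircle L)))
    (hφ : SupportedOn (cell L a) φ) (hf : SupportedOn (cell L b) f) (u v : HOne) :
    ∫ x, inner ℂ u (translate x (partialMatrixElement lam OB OC φ f x v)) =
      ∫ x, inner ℂ u
        (partialMatrixElement lam OB OC φ f x (translate (x + (b - a) • L) v)) := by
  simp only [inner_translate_partialMatrixElement_apply,
    inner_partialMatrixElement_translate_apply]
  have hint : ∀ k, Integrable fun x =>
      inner ℂ (φ x) (OC k f x) * inner ℂ u (translate x (OB k v)) := fun k => by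
    simpa only [add_zero] using integrable_inner_mul_inner_translate φ (OC k f) u (OB k v) 0
  rw [integral_finsetSum _ fun k _ => (hint k).const_mul _, integral_finsetSum _ fun k _ =>
    (integrable_inner_mul_inner_translate φ (OC k f) _ v _).const_mul _]
  simp only [integral_const_mul]
  rw [hS.sum_integral_inner_translate_eq hU]
  refine Finset.sum_congr rfl fun k _ => congrArg _ ?_
  rw [← integral_add_right_eq_self _ ((b - a) • L)]
  refine integral_congr_ae ?_
  filter_upwards [CommutesWithMul.ae_inner_apply_eq_inner_adjoint_apply hL (hOC k) hφ hf] with x hx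
  rw [hx]

theorem ae_mem_intertwiningPairs_partialMatrixElement (hS : IsSchmidtDecomposition O lam OB OC)
    (hU : ∀ ψ, controlledTranslation (O ψ) = O (controlledTranslation ψ)) (hL : 0 < L)
    (hOC : ∀ k (j : ℤ), CommutesWithMul (OC k) (fun x => fourier j (x : AddCircle L)))
    (hφ : SupportedOn (cell L a) φ) (hf : SupportedOn (cell L b) f) :
    ∀ᵐ x, (x, x + (b - a) • L) ∈ intertwiningPairs (partialMatrixElement lam OB OC φ f x) := by
  have : Fact ((2 : ENNReal) ≠ ⊤) := ⟨by simp⟩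
  suffices h : ∀ᵐ x, ∀ w : HOne × HOne,
      inner ℂ w.1 (translate x (partialMatrixElement lam OB OC φ f x w.2)) =
        inner ℂ w.1 (partialMatrixElement lam OB OC φ f x (translate (x + (b - a) • L) w.2)) by
    filter_upwards [h] with x hx v using ext_inner_left ℂ fun u => hx (u, v)
  refine ae_forall_eq_of_continuous (fun x => ?_) (fun x => ?_) fun ⟨u, v⟩ => ?_
  · have := (translate x).continuous
    fun_prop
  · have := (translate (x + (b - a) • L)).continuous
    fun_prop
  have hl := integrable_inner_translate_partialMatrixElement (lam := lam) (OB := OB) (OC := OC)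
    (φ := φ) (f := f) u v
  have hr := integrable_inner_partialMatrixElement_translate (lam := lam) (OB := OB) (OC := OC)
    (φ := φ) (f := f) u v ((b - a) • L)
  refine hl.ae_eq_of_forall_setIntegral_eq _ _ hr fun s hs _ => ?_
  -- The integral identity for `φ` cut off to `s` is the identity of set integrals over `s`.
  obtain ⟨φs, hφs⟩ := exists_coeFn_eq_indicator hs φ
  have hφs' : SupportedOn (cell L a) φs := by
    filter_upwards [hφs, hφ] with x hx h0 hxa
    rw [hx, Set.indicator_apply_eq_zero]
    exact fun _ => h0 hxa
  rw [← integral_indicator hs, ← integral_indicator hs]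
  convert hS.integral_inner_translate_partialMatrixElement hU hL hOC hφs' hf u v using 1 <;>
  · refine integral_congr_ae ?_
    filter_upwards [partialMatrixElement_ae_eq_indicator (lam := lam) (OB := OB) (OC := OC)
      (f := f) hφs] with x hx
    by_cases hxs : x ∈ s <;> simp [hx, hxs]

theorem ae_inner_apply_eq_zero (hS : IsSchmidtDecomposition O lam OB OC)
    (hU : ∀ ψ, controlledTranslation (O ψ) = O (controlledTranslation ψ)) (hL : 0 < L)
    (hOC : ∀ k (j : ℤ), CommutesWithMul (OC k) (fun x => fourier j (x : AddCircle L)))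
    (hφ : SupportedOn (cell L a) φ) (hf : SupportedOn (cell L b) f) (hab : a ≠ b) (k : Fin n) :
    ∀ᵐ x, inner ℂ (φ x) (OC k f x) = 0 := by
  have hd : (b - a) • L ≠ 0 := smul_ne_zero (sub_ne_zero.2 hab.symm) hL.ne'
  filter_upwards [ae_eq_zero_of_mem_intertwiningPairs (fun x => partialMatrixElement_mem_span x) hd
    (hS.ae_mem_intertwiningPairs_partialMatrixElement hU hL hOC hφ hf)] with x hx
  have hcoeff := Fintype.linearIndependent_iff.1 hS.linearIndependent_left _ hx k
  exact (mul_eq_zero.1 hcoeff).resolve_left (hS.coeff_ne_zero k)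

theorem commutesWithMul_of_bounded (hS : IsSchmidtDecomposition O lam OB OC)
    (hU : ∀ ψ, controlledTranslation (O ψ) = O (controlledTranslation ψ)) (hL : 0 < L)
    (hOC : ∀ k (j : ℤ), CommutesWithMul (OC k) (fun x => fourier j (x : AddCircle L)))
    (k : Fin n) {h : ℝ → ℂ} {C : ℝ} (hm : Measurable h)
    (hC : ∀ x, ‖h x‖ ≤ C) : CommutesWithMul (OC k) h := by
  refine .of_supportedOn (measurableSet_cell (L := L)) (iUnion_cell hL) hm hC
    fun a b φ f hφ hf => ?_
  have hfibre := CommutesWithMul.ae_inner_apply_eq_inner_adjoint_apply hL (hOC k) hφ hf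
  rcases eq_or_ne a b with rfl | hab
  · refine integral_congr_ae ?_
    filter_upwards [hfibre] with x hx
    rw [hx, sub_self, zero_smul, add_zero]
  · have hzero := hS.ae_inner_apply_eq_zero hU hL hOC hφ hf hab k
    rw [← integral_add_right_eq_self (fun x => h x * inner ℂ (adjoint (OC k) φ x) (f x))
      ((b - a) • L)]
    refine integral_congr_ae ?_
    filter_upwards [hfibre, hzero] with x hx h0
    rw [← hx, h0, mul_zero, mul_zero]

end IsSchmidtDecomposition

end QRF

theorem theorem1_general (P : ℝ) (hP : P ≠ 0) (O : QRF.HBC →L[ℂ] QRF.HBC)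
    (n : ℕ) (lam : Fin n → ℝ) (OB OC : Fin n → (QRF.HOne →L[ℂ] QRF.HOne))
    (hSchmidt : QRF.IsSchmidtDecomposition O lam OB OC)
    (hinv : QRF.IsInvariant QRF.standardTransform O) :
    QRF.IsInvariant (QRF.transform P) O ↔
      ∀ k : Fin n, QRF.CommutesWith QRF.position (OC k) := by
  rw [QRF.isInvariant_transform_iff hinv]
  simp only [QRF.commutesWith_position_iff]
  constructor
  · intro hphase k
    have hU := QRF.isInvariant_standardTransform_iff.1 hinv
    have hL : 0 < 2 * Real.pi / |P| := div_pos Real.two_pi_pos (abs_pos.2 hP)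
    have hfourier := fun k => (hSchmidt.commutesWithMul_of_phase_comm hphase k).fourier hP
    exact .position_of_bounded fun h C hm hC =>
      hSchmidt.commutesWithMul_of_bounded hU hL hfourier k hm hC
  · exact fun hpos => hSchmidt.phase_comm_of_commutesWithMul fun k => (hpos k).exp_of_position P

theorem theorem1 (P : ℝ) (hP : P ≠ 0) (O : QRF.HBC →L[ℂ] QRF.HBC) (hO : IsSelfAdjoint O)
    (n : ℕ) (lam : Fin n → ℝ) (OB OC : Fin n → (QRF.HOne →L[ℂ] QRF.HOne))
    (hSchmidt : QRF.IsSchmidtDecomposition O lam OB OC)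
    (hinv : QRF.IsInvariant QRF.standardTransform O) :
    QRF.IsInvariant (QRF.transform P) O ↔
      ∀ k : Fin n, QRF.CommutesWith QRF.position (OC k) :=
  theorem1_general P hP O n lam OB OC hSchmidt hinv
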